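/- For a field $\mathbb F$, let $W(\mathbb F)$ be the Witt group of $\mathbb F$: the set of classes $[B]$ of non-degenerate symmetric bilinear forms $B$ on finite-dimensional $\mathbb F$-vector spaces, where $[B_1]=[B_2]$ if $B_1\oplus M_1\cong B_2\oplus M_2$ for some metabolic forms $M_1,M_2$ (forms having a totally isotropic subspace of half the dimension), with the addition $\oplus$ induced by orthogonal direct sum. For $a\in\mathbb F^\ast$ write $[a]$ for the class of the rank one form $\langle a\rangle(x,y)=axy$. For a prime $q$, let $\partial_q\colon W(\mathbb Q)\to W(\mathbb F_q)$ be the composition of the map $W(\mathbb Q)\to W(\mathbb Q_q)$ given by extension of scalars with the second residue homomorphism $W(\mathbb Q_q)\to W(\mathbb F_q)$ for the uniformizer $q$, that is, the homomorphism with $[u]\mapsto 0$ and $[qu]\mapsto[\bar u]$ for every unit $u$ of $\mathbb Z_q$, where $\bar u$ is the reduction of $u$ modulo $q$. Let $\partial=\bigoplus_q\partial_q\colon W(\mathbb Q)\to\bigoplus_{q\text{ prime}}W(\mathbb F_q)$. For a knot $K$ with Seifert surface $S$ and Seifert form $V_S(\alpha,\beta)=\ell k(a,b^+)$ on $H_1(S;\mathbb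 Z)$ (where $a,b$ are curves on $S$ representing $\alpha,\beta$, and $b^+$ is a small push-off of $b$ in the positive normal direction), let $W(K)\in W(\mathbb Q)$ be the class of the form $V_S+V_S^\tau$ on $H_1(S;\mathbb Q)$, where $V_S^\tau(\alpha,\beta)=V_S(\beta,\alpha)$; it does not depend on $S$. The Witt span of $K$ is $$ws(K)=\min\{\operatorname{rank}B \mid \partial[B]=\partial(W(K))\},$$ where $B$ ranges over all non-degenerate symmetric bilinear forms of finite rank over $\mathbb Q$. **Theorem.** Let $K$ be a knot, let $p\equiv 1\pmod 4$ be a prime, and let $\beta\in\mathbb F_p$ be any non-square. Assume that $\partial_q(W(K))=0$ for all primes $q\neq p$. (i) If $\partial_p(W(K))=[\beta]\in W(\mathbb F_p)$, then $ws(K)=2$. (ii) If $\partial_p(W(K))=[1]\oplus[\beta]\in W(\mathbb F_p)$, then $ws(K)=3$. -/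

import Mathlib

noncomputable section

open Module TensorProduct

/-- A finite-dimensional vector space over `F` with a non-degenerate symmetric bilinear form. -/
structure SymForm (F : Type) [Field F] where
  V : Type
  [addCommGroup : AddCommGroup V]
  [module : Module F V]
  [finite : FiniteDimensional F V]
  B : LinearMap.BilinForm F V
  symm : ∀ x y, B x y = B y x
  nondeg : ∀ x, (∀ y, B x y = 0) → x = 0

attribute [instance] SymForm.addCommGroup SymForm.module SymForm.finite

/-- The space has a totally isotropic subspace of half its dimension. -/
def HalfIsotropic {F V : Type} [Field F] [AddCommGroup V] [Module F V]
    (B : LinearMap.BilinForm F V) : Prop :=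
  ∃ N : Submodule F V, (∀ x ∈ N, ∀ y ∈ N, B x y = 0) ∧ finrank F V = 2 * finrank F N

/-- The orthogonal direct sum of two bilinear forms. -/
def prodForm {F V W : Type} [Field F] [AddCommGroup V] [Module F V] [AddCommGroup W] [Module F W]
    (B : LinearMap.BilinForm F V) (C : LinearMap.BilinForm F W) :
    LinearMap.BilinForm F (V × W) :=
  B.comp (LinearMap.fst F V W) (LinearMap.fst F V W) +
    C.comp (LinearMap.snd F V W) (LinearMap.snd F V W)

section

variable {F V W : Type} [Field F] [AddCommGroup V] [Module F V] [AddCommGroup W] [Module F W]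

lemma prodForm_apply (B : LinearMap.BilinForm F V) (C : LinearMap.BilinForm F W) (x y : V × W) :
    prodForm B C x y = B x.1 y.1 + C x.2 y.2 := rfl

lemma HalfIsotropic.congr {B : LinearMap.BilinForm F V} {C : LinearMap.BilinForm F W}
    (h : HalfIsotropic B) (e : V ≃ₗ[F] W) (he : ∀ x y, C (e x) (e y) = B x y) :
    HalfIsotropic C := by
  obtain ⟨N, hN, hd⟩ := h
  refine ⟨N.map (e : V →ₗ[F] W), ?_, ?_⟩
  · rintro _ ⟨x, hx, rfl⟩ _ ⟨y, hy, rfl⟩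
    exact (he x y).trans (hN x hx y hy)
  · rw [← e.finrank_eq, hd, LinearEquiv.finrank_map_eq e N]

lemma HalfIsotropic.prod [FiniteDimensional F V] [FiniteDimensional F W]
    {B : LinearMap.BilinForm F V} {C : LinearMap.BilinForm F W}
    (h : HalfIsotropic B) (h' : HalfIsotropic C) : HalfIsotropic (prodForm B C) := by
  obtain ⟨N, hN, hd⟩ := h
  obtain ⟨N', hN', hd'⟩ := h'
  refine ⟨N.prod N', ?_, ?_⟩
  · rintro x ⟨hx, hx'⟩ y ⟨hy, hy'⟩
    simp [prodForm_apply, hN _ hx _ hy, hN' _ hx' _ hy']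
  · have h : finrank F (N.prod N') = finrank F N + finrank F N' := by
      rw [← Module.finrank_prod]
      exact LinearEquiv.finrank_eq
        { toFun := fun x => (⟨x.1.1, x.2.1⟩, ⟨x.1.2, x.2.2⟩)
          invFun := fun x => ⟨(x.1, x.2), x.1.2, x.2.2⟩
          map_add' := fun _ _ => rfl
          map_smul' := fun _ _ => rfl }
    rw [Module.finrank_prod, h]; omega

lemma HalfIsotropic.neg {B : LinearMap.BilinForm F V} (h : HalfIsotropic B) :
    HalfIsotropic (-B) := by
  obtain ⟨N, hN, hd⟩ := h
  exact ⟨N, fun x hx y hy => by simp [hN x hx y hy], hd⟩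

lemma HalfIsotropic.prod_neg [FiniteDimensional F V] (B : LinearMap.BilinForm F V) :
    HalfIsotropic (prodForm B (-B)) := by
  refine ⟨LinearMap.range (LinearMap.prod LinearMap.id LinearMap.id : V →ₗ[F] V × V), ?_, ?_⟩
  · rintro _ ⟨x, rfl⟩ _ ⟨y, rfl⟩
    exact add_neg_cancel (B x y)
  · rw [LinearMap.finrank_range_of_inj (fun x y h => congrArg Prod.fst h), Module.finrank_prod]
    omega

end

namespace SymForm

variable {F : Type} [Field F]

/-- The rank of a form: the dimension of the underlying space. -/
def rank (A : SymForm F) : ℕ := finrank F A.V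

/-- Two forms are isometric if there is a linear isomorphism that carries one to the other. -/
def Isometric (A B : SymForm F) : Prop :=
  ∃ e : A.V ≃ₗ[F] B.V, ∀ x y, B.B (e x) (e y) = A.B x y

/-- A form is metabolic if it has a totally isotropic subspace of half the dimension. -/
def Metabolic (A : SymForm F) : Prop := HalfIsotropic A.B

/-- The orthogonal direct sum. -/
def oplus (A B : SymForm F) : SymForm F where
  V := A.V × B.V
  B := prodForm A.B B.B
  symm x y := by simp [prodForm_apply, A.symm x.1, B.symm x.2]
  nondeg x h := by
    refine Prod.ext (A.nondeg _ fun y => ?_) (B.nondeg _ fun y => ?_)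
    · simpa [prodForm_apply] using h (y, 0)
    · simpa [prodForm_apply] using h (0, y)

/-- The form `(V, -B)`. -/
def neg (A : SymForm F) : SymForm F where
  V := A.V
  B := -A.B
  symm x y := by simp [A.symm x]
  nondeg x h := A.nondeg x fun y => by simpa using h y

/-- The form on the zero space. -/
def zero (F : Type) [Field F] : SymForm F where
  V := PUnit
  B := 0
  symm _ _ := rfl
  nondeg _ _ := rfl

/-- The form `⟨a⟩` of rank one, `(x, y) ↦ a x y`. -/
def rankOne (a : Fˣ) : SymForm F where
  V := F
  B := (a : F) • LinearMap.mul F F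
  symm x y := by simp [mul_comm x y]
  nondeg x h := by simpa using h 1

@[simp] lemma oplus_apply (A B : SymForm F) (x y : A.V × B.V) :
    (A.oplus B).B x y = A.B x.1 y.1 + B.B x.2 y.2 := rfl

@[simp] lemma neg_apply (A : SymForm F) (x y : A.V) : A.neg.B x y = -A.B x y := rfl

@[simp] lemma rankOne_apply (a : Fˣ) (x y : F) : (rankOne a).B x y = a * (x * y) := rfl

lemma Isometric.refl (A : SymForm F) : A.Isometric A := ⟨LinearEquiv.refl _ _, fun _ _ => rfl⟩

lemma Isometric.symm {A B : SymForm F} : A.Isometric B → B.Isometric A := by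
  rintro ⟨e, he⟩
  exact ⟨e.symm, fun x y => by simpa using (he (e.symm x) (e.symm y)).symm⟩

lemma Isometric.trans {A B C : SymForm F} : A.Isometric B → B.Isometric C → A.Isometric C := by
  rintro ⟨e, he⟩ ⟨f, hf⟩
  exact ⟨e.trans f, fun x y => by simp [hf, he]⟩

lemma Isometric.oplus {A B C D : SymForm F} : A.Isometric B → C.Isometric D →
    (A.oplus C).Isometric (B.oplus D) := by
  rintro ⟨e, he⟩ ⟨f, hf⟩
  exact ⟨e.prodCongr f, fun x y => congrArg₂ (· + ·) (he _ _) (hf _ _)⟩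

lemma Isometric.neg {A B : SymForm F} : A.Isometric B → A.neg.Isometric B.neg := by
  rintro ⟨e, he⟩
  exact ⟨e, fun x y => congrArg (- ·) (he x y)⟩

lemma oplus_comm (A B : SymForm F) : (A.oplus B).Isometric (B.oplus A) :=
  ⟨LinearEquiv.prodComm F A.V B.V, fun _ _ => add_comm _ _⟩

lemma oplus_assoc (A B C : SymForm F) :
    ((A.oplus B).oplus C).Isometric (A.oplus (B.oplus C)) :=
  ⟨LinearEquiv.prodAssoc F A.V B.V C.V, fun _ _ => (add_assoc _ _ _).symm⟩

lemma oplus_zero (A : SymForm F) : (A.oplus (zero F)).Isometric A :=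
  ⟨LinearEquiv.prodUnique (R := F) (M := A.V) (M₂ := PUnit), fun _ _ => (add_zero _).symm⟩

lemma oplus_swap (A B C D : SymForm F) :
    ((A.oplus B).oplus (C.oplus D)).Isometric ((A.oplus C).oplus (B.oplus D)) :=
  ⟨LinearEquiv.prodProdProdComm F A.V B.V C.V D.V, fun _ _ => add_add_add_comm _ _ _ _⟩

lemma metabolic_zero : (zero F).Metabolic :=
  ⟨⊥, fun _ _ _ _ => rfl, by
    change finrank F PUnit = 2 * finrank F (⊥ : Submodule F PUnit)
    simp [finrank_zero_of_subsingleton]⟩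

lemma Metabolic.of_isometric {A B : SymForm F} : A.Isometric B → A.Metabolic → B.Metabolic :=
  fun ⟨e, he⟩ h => HalfIsotropic.congr h e he

lemma Metabolic.oplus {A B : SymForm F} (h : A.Metabolic) (h' : B.Metabolic) :
    (A.oplus B).Metabolic := HalfIsotropic.prod h h'

lemma Metabolic.neg {A : SymForm F} (h : A.Metabolic) : A.neg.Metabolic := HalfIsotropic.neg h

lemma metabolic_oplus_neg (A : SymForm F) : (A.oplus A.neg).Metabolic :=
  HalfIsotropic.prod_neg A.B

/-- Witt equivalence: forms become isometric after adding metabolic forms. -/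
def WittEquiv (A B : SymForm F) : Prop :=
  ∃ M N : SymForm F, M.Metabolic ∧ N.Metabolic ∧ (A.oplus M).Isometric (B.oplus N)

lemma Isometric.wittEquiv {A B : SymForm F} (h : A.Isometric B) : A.WittEquiv B :=
  ⟨_, _, metabolic_zero, metabolic_zero, h.oplus (.refl _)⟩

lemma Metabolic.wittEquiv {A : SymForm F} (h : A.Metabolic) : A.WittEquiv (zero F) :=
  ⟨_, _, metabolic_zero, h, oplus_comm _ _⟩

lemma WittEquiv.trans {A B C : SymForm F} : A.WittEquiv B → B.WittEquiv C → A.WittEquiv C := by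
  rintro ⟨M, N, hM, hN, h⟩ ⟨M', N', hM', hN', h'⟩
  refine ⟨M.oplus M', N'.oplus N, hM.oplus hM', hN'.oplus hN, ?_⟩
  refine (oplus_assoc _ _ _).symm.trans <| (h.oplus (.refl _)).trans <|
    (oplus_assoc _ _ _).trans <| ((Isometric.refl _).oplus (oplus_comm _ _)).trans <|
    (oplus_assoc _ _ _).symm.trans <| (h'.oplus (.refl _)).trans (oplus_assoc _ _ _)

lemma WittEquiv.oplus {A B C D : SymForm F} : A.WittEquiv B → C.WittEquiv D →
    (A.oplus C).WittEquiv (B.oplus D) := by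
  rintro ⟨M, N, hM, hN, h⟩ ⟨M', N', hM', hN', h'⟩
  exact ⟨_, _, hM.oplus hM', hN.oplus hN', (oplus_swap _ _ _ _).trans <|
    (h.oplus h').trans (oplus_swap _ _ _ _)⟩

lemma neg_oplus (A B : SymForm F) : (A.oplus B).neg.Isometric (A.neg.oplus B.neg) :=
  ⟨LinearEquiv.refl F (A.V × B.V), fun _ _ => (neg_add _ _).symm⟩

lemma WittEquiv.neg {A B : SymForm F} : A.WittEquiv B → A.neg.WittEquiv B.neg := by
  rintro ⟨M, N, hM, hN, h⟩
  exact ⟨_, _, hM.neg, hN.neg, (neg_oplus _ _).symm.trans (h.neg.trans (neg_oplus _ _))⟩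

instance wittSetoid (F : Type) [Field F] : Setoid (SymForm F) where
  r := WittEquiv
  iseqv := ⟨fun A => (Isometric.refl A).wittEquiv,
    fun ⟨M, N, hM, hN, h⟩ => ⟨N, M, hN, hM, h.symm⟩, WittEquiv.trans⟩

end SymForm

/-- The additive group of the Witt ring of `F`. -/
def WittGroup (F : Type) [Field F] : Type 1 := Quotient (SymForm.wittSetoid F)

namespace WittGroup

variable {F : Type} [Field F]

/-- The Witt class `[A]`. -/
def mk (A : SymForm F) : WittGroup F := Quotient.mk _ A

instance : Zero (WittGroup F) := ⟨mk (SymForm.zero F)⟩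

instance : Add (WittGroup F) :=
  ⟨Quotient.map₂ SymForm.oplus fun _ _ h _ _ h' => SymForm.WittEquiv.oplus h h'⟩

instance : Neg (WittGroup F) := ⟨Quotient.map SymForm.neg fun _ _ h => SymForm.WittEquiv.neg h⟩

instance : AddCommGroup (WittGroup F) where
  nsmul := nsmulRec
  zsmul := zsmulRec
  add_assoc := by
    rintro ⟨A⟩ ⟨B⟩ ⟨C⟩; exact Quotient.sound (SymForm.oplus_assoc A B C).wittEquiv
  zero_add := by
    rintro ⟨A⟩
    exact Quotient.sound ((SymForm.oplus_comm _ _).trans (SymForm.oplus_zero A)).wittEquiv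
  add_zero := by rintro ⟨A⟩; exact Quotient.sound (SymForm.oplus_zero A).wittEquiv
  neg_add_cancel := by
    rintro ⟨A⟩
    exact Quotient.sound ((SymForm.metabolic_oplus_neg A).of_isometric
      (SymForm.oplus_comm _ _)).wittEquiv
  add_comm := by rintro ⟨A⟩ ⟨B⟩; exact Quotient.sound (SymForm.oplus_comm A B).wittEquiv

/-- The Witt class `[a]` of the rank one form `⟨a⟩`. -/
def unit (a : Fˣ) : WittGroup F := mk (SymForm.rankOne a)

lemma mk_oplus (A B : SymForm F) : mk (A.oplus B) = mk A + mk B := rfl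

lemma mk_neg (A : SymForm F) : mk A.neg = -mk A := rfl

lemma mk_eq_of_isometric {A B : SymForm F} (h : A.Isometric B) : mk A = mk B :=
  Quotient.sound h.wittEquiv

lemma mk_eq_zero {A : SymForm F} (h : A.Metabolic) : mk A = 0 := Quotient.sound h.wittEquiv

end WittGroup

/-! Diagonal forms, and additive maps out of the Witt group given on rank one forms. -/

/-- The bilinear form `∑ i, a i * x i * y i`. -/
def diagForm {F ι : Type} [Field F] [Fintype ι] (a : ι → Fˣ) : LinearMap.BilinForm F (ι → F) :=
  ∑ i, (a i : F) • (LinearMap.mul F F).compl₁₂ (LinearMap.proj i) (LinearMap.proj i)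

lemma diagForm_apply {F ι : Type} [Field F] [Fintype ι] (a : ι → Fˣ) (x y : ι → F) :
    diagForm a x y = ∑ i, (a i : F) * (x i * y i) := by
  simp [diagForm, LinearMap.sum_apply]

namespace SymForm

variable {F : Type} [Field F]

/-- The diagonal form `⟨a₁⟩ ⊕ ⋯ ⊕ ⟨aₙ⟩`. -/
def diag {ι : Type} [Fintype ι] (a : ι → Fˣ) : SymForm F where
  V := ι → F
  B := diagForm a
  symm x y := by simp only [diagForm_apply, mul_comm (x _)]
  nondeg x h := by
    classical
    ext i
    have := h (Pi.single i 1)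
    simpa [diagForm_apply, Pi.single_apply] using this

lemma diag_fin_zero (a : Fin 0 → Fˣ) : (diag a).Isometric (zero F) :=
  ⟨(0 : (Fin 0 → F) ≃ₗ[F] PUnit), fun (x y : Fin 0 → F) => by
    change (0 : F) = diagForm a x y
    simp [diagForm_apply]⟩

lemma diag_fin_succ {n : ℕ} (a : Fin (n + 1) → Fˣ) :
    ((rankOne (a 0)).oplus (diag fun i : Fin n => a i.succ)).Isometric (diag a) :=
  ⟨Fin.consLinearEquiv F (fun _ : Fin (n + 1) => F), fun (x y : F × (Fin n → F)) => by
    change diagForm a (Fin.cons x.1 x.2 : Fin (n + 1) → F) (Fin.cons y.1 y.2 : Fin (n + 1) → F) =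
      (a 0 : F) * (x.1 * y.1) + diagForm (fun i : Fin n => a i.succ) x.2 y.2
    rw [diagForm_apply, diagForm_apply, Fin.sum_univ_succ]
    simp⟩

lemma diag_reindex {ι κ : Type} [Fintype ι] [Fintype κ] (e : κ ≃ ι) (a : ι → Fˣ) :
    (diag a).Isometric (diag (a ∘ e)) :=
  ⟨LinearEquiv.funCongrLeft F F e, fun (x y : ι → F) => by
      change diagForm (a ∘ e) (x ∘ e) (y ∘ e) = diagForm a x y
      rw [diagForm_apply, diagForm_apply, ← e.sum_comp]
      rfl⟩

lemma mk_diag_fin {n : ℕ} (a : Fin n → Fˣ) :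
    WittGroup.mk (diag a) = ∑ i, WittGroup.unit (a i) := by
  induction n with
  | zero =>
    rw [Fin.sum_univ_zero]
    exact WittGroup.mk_eq_of_isometric (diag_fin_zero a)
  | succ n ih =>
    rw [Fin.sum_univ_succ, ← ih, ← WittGroup.mk_eq_of_isometric (diag_fin_succ a)]
    rfl

lemma mk_diag {ι : Type} [Fintype ι] (a : ι → Fˣ) :
    WittGroup.mk (diag a) = ∑ i, WittGroup.unit (a i) := by
  rw [WittGroup.mk_eq_of_isometric (diag_reindex (Fintype.equivFin ι).symm a), mk_diag_fin,
    ← (Fintype.equivFin ι).symm.sum_comp]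
  rfl

lemma exists_diag (h2 : (2 : F) ≠ 0) (A : SymForm F) :
    ∃ a : Fin (finrank F A.V) → Fˣ, A.Isometric (diag a) := by
  have : Invertible (2 : F) := invertibleOfNonzero h2
  obtain ⟨v, hv⟩ := LinearMap.BilinForm.exists_orthogonal_basis (B := A.B) ⟨A.symm⟩
  have hv' : ∀ i j, i ≠ j → A.B (v i) (v j) = 0 := fun i j hij => hv hij
  have h0 : ∀ i, A.B (v i) (v i) ≠ 0 := fun i hi => v.ne_zero i <| A.nondeg _ fun y => by
    rw [← v.sum_repr y, map_sum]
    refine Finset.sum_eq_zero fun j _ => ?_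
    rw [map_smul]
    rcases eq_or_ne i j with rfl | hij
    · simp [hi]
    · simp [hv' i j hij]
  refine ⟨fun i => Units.mk0 _ (h0 i), v.equivFun, fun x y => ?_⟩
  change diagForm _ (v.equivFun x) (v.equivFun y) = _
  rw [diagForm_apply]
  conv_rhs => rw [← v.sum_repr x, ← v.sum_repr y]
  simp only [map_sum, LinearMap.sum_apply, map_smul, LinearMap.smul_apply, Basis.equivFun_apply,
    Units.val_mk0, smul_eq_mul]
  refine Finset.sum_congr rfl fun i _ => ?_
  rw [Finset.sum_eq_single i]
  · ring
  · intro j _ hj; simp [hv' j i hj]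
  · simp

lemma diag_oplus {ι κ : Type} [Fintype ι] [Fintype κ] (a : ι → Fˣ) (b : κ → Fˣ) :
    ((diag a).oplus (diag b)).Isometric (diag (Sum.elim a b)) :=
  ⟨(LinearEquiv.sumArrowLequivProdArrow ι κ F F).symm, fun (x y : (ι → F) × (κ → F)) => by
    change diagForm (Sum.elim a b) (Sum.elim x.1 x.2) (Sum.elim y.1 y.2) =
      diagForm a x.1 y.1 + diagForm b x.2 y.2
    simp [diagForm_apply]⟩

lemma diag_neg {ι : Type} [Fintype ι] (a : ι → Fˣ) :
    (diag a).neg.Isometric (diag (-a)) :=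
  ⟨LinearEquiv.refl F (ι → F), fun (x y : ι → F) => by
    change diagForm (-a) x y = -diagForm a x y
    simp [diagForm_apply]⟩

end SymForm

namespace WittGroup

variable {F : Type} [Field F] {G : Type*} [AddCommGroup G]

/-- A function on units vanishes on metabolic diagonal forms. -/
def KillsMetabolic (φ : Fˣ → G) : Prop :=
  ∀ (ι : Type) [Fintype ι] (a : ι → Fˣ), (SymForm.diag a).Metabolic → ∑ i, φ (a i) = 0

lemma KillsMetabolic.neg {φ : Fˣ → G} (hφ : KillsMetabolic φ) (a : Fˣ) : φ (-a) = -φ a := by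
  have := hφ (Unit ⊕ Unit) (Sum.elim (fun _ => a) (-(fun _ => a))) <|
    (SymForm.metabolic_oplus_neg (SymForm.diag fun _ : Unit => a)).of_isometric <|
    ((SymForm.Isometric.refl _).oplus (SymForm.diag_neg _)).trans (SymForm.diag_oplus _ _)
  simp at this
  exact (neg_eq_of_add_eq_zero_right this).symm

lemma KillsMetabolic.eq_of_wittEquiv {φ : Fˣ → G} (hφ : KillsMetabolic φ) (h2 : (2 : F) ≠ 0)
    {ι κ : Type} [Fintype ι] [Fintype κ] {a : ι → Fˣ} {b : κ → Fˣ}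
    (h : (SymForm.diag a).WittEquiv (SymForm.diag b)) : ∑ i, φ (a i) = ∑ i, φ (b i) := by
  obtain ⟨M, N, hM, hN, h⟩ := h
  obtain ⟨m, hm⟩ := M.exists_diag h2
  obtain ⟨n, hn⟩ := N.exists_diag h2
  have e : (SymForm.diag (Sum.elim a m)).Isometric (SymForm.diag (Sum.elim b n)) :=
    (SymForm.diag_oplus _ _).symm.trans <| ((SymForm.Isometric.refl _).oplus hm.symm).trans <|
      h.trans <| ((SymForm.Isometric.refl _).oplus hn).trans (SymForm.diag_oplus _ _)
  have := hφ _ (Sum.elim (Sum.elim a m) (-(Sum.elim b n))) <|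
    (SymForm.metabolic_oplus_neg (SymForm.diag (Sum.elim a m))).of_isometric <|
    ((SymForm.Isometric.refl _).oplus (e.neg.trans (SymForm.diag_neg _))).trans
      (SymForm.diag_oplus _ _)
  have h1 := hφ _ m (hM.of_isometric hm)
  have h3 := hφ _ n (hN.of_isometric hn)
  simp [hφ.neg, h1, h3] at this
  exact sub_eq_zero.mp (by rw [sub_eq_add_neg]; exact this)

/-- The additive map on the Witt group with prescribed values on the classes `[a]`. -/
def lift (h2 : (2 : F) ≠ 0) (φ : Fˣ → G) (hφ : KillsMetabolic φ) : WittGroup F →+ G :=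
  AddMonoidHom.mk' (Quotient.lift (fun A : SymForm F => ∑ i, φ ((A.exists_diag h2).choose i))
    fun A B h => hφ.eq_of_wittEquiv h2 <| by
      have hA : (SymForm.diag (A.exists_diag h2).choose).WittEquiv A :=
        (A.exists_diag h2).choose_spec.symm.wittEquiv
      exact hA.trans (SymForm.WittEquiv.trans h (B.exists_diag h2).choose_spec.wittEquiv)) <| by
    rintro ⟨A⟩ ⟨B⟩
    change ∑ i, φ (((A.oplus B).exists_diag h2).choose i) =
      ∑ i, φ ((A.exists_diag h2).choose i) + ∑ i, φ ((B.exists_diag h2).choose i)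
    have : ∑ i, φ (((A.oplus B).exists_diag h2).choose i) =
        ∑ i, φ (Sum.elim (A.exists_diag h2).choose (B.exists_diag h2).choose i) :=
      hφ.eq_of_wittEquiv h2 <| SymForm.Isometric.wittEquiv <|
        ((A.oplus B).exists_diag h2).choose_spec.symm.trans <|
        ((A.exists_diag h2).choose_spec.oplus (B.exists_diag h2).choose_spec).trans
          (SymForm.diag_oplus _ _)
    rw [this, Fintype.sum_sum_type]
    rfl

lemma lift_unit (h2 : (2 : F) ≠ 0) (φ : Fˣ → G) (hφ : KillsMetabolic φ) (a : Fˣ) :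
    lift h2 φ hφ (unit a) = φ a := by
  have h : (SymForm.diag (fun _ : Unit => a)).Isometric (SymForm.rankOne a) :=
    ⟨LinearEquiv.funUnique Unit F F, fun (x y : Unit → F) => by
      change (a : F) * (x default * y default) = diagForm _ x y
      simp [diagForm_apply]⟩
  have := hφ.eq_of_wittEquiv h2 ((h.trans ((SymForm.rankOne a).exists_diag h2).choose_spec).wittEquiv)
  simp only [Finset.univ_unique, Finset.sum_singleton] at this
  exact this.symm

end WittGroup

/-! Extension of scalars. -/

section BaseChange

variable {F : Type} [Field F] (L : Type) [Field L] [Algebra F L]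

lemma baseChange_nondeg {V : Type} [AddCommGroup V] [Module F V] [FiniteDimensional F V]
    (B : LinearMap.BilinForm F V) (hs : ∀ x y, B x y = B y x) (h : ∀ x, (∀ y, B x y = 0) → x = 0)
    (x : L ⊗[F] V) (hx : ∀ y, B.baseChange L x y = 0) : x = 0 := by
  classical
  let b := Module.finBasis F V
  have hB : B.Nondegenerate := (LinearMap.IsRefl.nondegenerate_iff_separatingLeft
    (fun x y hxy => by rw [hs, hxy])).mpr h
  have h1 := (LinearMap.BilinForm.nondegenerate_iff_det_ne_zero b).mp hB
  have h2 : (LinearMap.BilinForm.toMatrix (b.baseChange L)) (B.baseChange L) =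
      (LinearMap.BilinForm.toMatrix b B).map (algebraMap F L) := by
    ext i j
    simp [LinearMap.BilinForm.toMatrix_apply, Algebra.algebraMap_eq_smul_one]
  have h3 : (B.baseChange L).Nondegenerate := by
    rw [LinearMap.BilinForm.nondegenerate_iff_det_ne_zero (b.baseChange L), h2]
    rw [← RingHom.mapMatrix_apply, ← RingHom.map_det]
    simpa using h1
  exact h3.1 x hx

lemma HalfIsotropic.baseChange {V : Type} [AddCommGroup V] [Module F V] [FiniteDimensional F V]
    {B : LinearMap.BilinForm F V} (h : HalfIsotropic B) : HalfIsotropic (B.baseChange L) := by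
  obtain ⟨N, hN, hd⟩ := h
  refine ⟨LinearMap.range (N.subtype.baseChange L), ?_, ?_⟩
  · rintro _ ⟨x, rfl⟩ _ ⟨y, rfl⟩
    induction x using TensorProduct.induction_on with
    | zero => simp
    | add x x' hx hx' => simp [hx, hx']
    | tmul l n =>
      induction y using TensorProduct.induction_on with
      | zero => simp
      | add y y' hy hy' => rw [map_add, map_add, hy, hy', add_zero]
      | tmul l' n' => simp [hN n n.2 n' n'.2]
  · rw [LinearMap.finrank_range_of_inj, Module.finrank_baseChange, Module.finrank_baseChange, hd]
    exact Module.Flat.lTensor_preserves_injective_linearMap (M := L) N.subtype N.injective_subtype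

/-- Extension of scalars of a form along a field extension. -/
def SymForm.baseChange (A : SymForm F) : SymForm L where
  V := L ⊗[F] A.V
  B := A.B.baseChange L
  symm x y := (LinearMap.BilinForm.IsSymm.baseChange (A := L) (B₂ := A.B) ⟨A.symm⟩).eq x y
  nondeg := baseChange_nondeg L A.B A.symm A.nondeg

lemma SymForm.Isometric.baseChange {A B : SymForm F} :
    A.Isometric B → (A.baseChange L).Isometric (B.baseChange L) := by
  rintro ⟨e, he⟩
  refine ⟨e.baseChange F L A.V B.V, fun (x y : L ⊗[F] A.V) => ?_⟩
  change B.B.baseChange L (e.baseChange F L A.V B.V x) (e.baseChange F L A.V B.V y) =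
    A.B.baseChange L x y
  induction x using TensorProduct.induction_on with
  | zero => simp
  | add x x' hx hx' => simp [hx, hx']
  | tmul l n =>
    induction y using TensorProduct.induction_on with
    | zero => simp
    | add y y' hy hy' => rw [map_add, map_add, map_add, hy, hy']
    | tmul l' n' => simp [he]

lemma SymForm.baseChange_oplus (A B : SymForm F) :
    ((A.oplus B).baseChange L).Isometric ((A.baseChange L).oplus (B.baseChange L)) := by
  refine ⟨TensorProduct.prodRight F L L A.V B.V, fun (x y : L ⊗[F] (A.V × B.V)) => ?_⟩
  change prodForm (A.B.baseChange L) (B.B.baseChange L) (TensorProduct.prodRight F L L A.V B.V x)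
    (TensorProduct.prodRight F L L A.V B.V y) = (prodForm A.B B.B).baseChange L x y
  induction x using TensorProduct.induction_on with
  | zero => simp
  | add x x' hx hx' => simp [hx, hx']
  | tmul l n =>
    induction y using TensorProduct.induction_on with
    | zero => simp
    | add y y' hy hy' => rw [map_add, map_add, map_add, hy, hy']
    | tmul l' n' => simp [prodForm_apply, add_smul]

/-- The map `W(F) → W(L)` induced by a field extension, `[A] ↦ [L ⊗ A]`. -/
def WittGroup.baseChange : WittGroup F →+ WittGroup L :=
  AddMonoidHom.mk' (Quotient.lift (fun A : SymForm F => WittGroup.mk (A.baseChange L)) <| by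
    rintro A B ⟨M, N, hM, hN, h⟩
    have := WittGroup.mk_eq_of_isometric <| (SymForm.baseChange_oplus L A M).symm.trans <|
      (h.baseChange L).trans (SymForm.baseChange_oplus L B N)
    have hM' : WittGroup.mk (M.baseChange L) = 0 :=
      WittGroup.mk_eq_zero (HalfIsotropic.baseChange L hM)
    have hN' : WittGroup.mk (N.baseChange L) = 0 :=
      WittGroup.mk_eq_zero (HalfIsotropic.baseChange L hN)
    rwa [WittGroup.mk_oplus, WittGroup.mk_oplus, hM', hN', add_zero, add_zero] at this) <| by
  rintro ⟨A⟩ ⟨B⟩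
  exact WittGroup.mk_eq_of_isometric (SymForm.baseChange_oplus L A B)

end BaseChange

/-! The residue maps. -/

lemma diagForm_nondegenerate {F ι : Type} [Field F] [Fintype ι] (a : ι → Fˣ) :
    (diagForm a).Nondegenerate :=
  (LinearMap.IsRefl.nondegenerate_iff_separatingLeft (fun x y hxy => by
    rw [← hxy]; exact (SymForm.diag a).symm y x)).mpr (SymForm.diag a).nondeg

lemma diagForm_halfIsotropic_iff {F ι : Type} [Field F] [Fintype ι] (a : ι → Fˣ) :
    HalfIsotropic (diagForm a) ↔ ∃ N : Submodule F (ι → F),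
      ∀ z, z ∈ N ↔ ∀ w ∈ N, diagForm a w z = 0 := by
  have key := LinearMap.BilinForm.finrank_orthogonal (diagForm_nondegenerate a)
  constructor
  · rintro ⟨N, hN, hd⟩
    have hle : N ≤ (diagForm a).orthogonal N := fun z hz w hw => hN w hw z hz
    have := Submodule.eq_of_le_of_finrank_eq hle (by rw [key, hd]; omega)
    refine ⟨N, fun z => ⟨fun hz w hw => hN w hw z hz, fun hz => ?_⟩⟩
    rw [this]; exact hz
  · rintro ⟨N, hN⟩
    have : (diagForm a).orthogonal N = N := by
      ext z; exact (hN z).symm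
    have h1 := key N
    rw [this] at h1
    have h2 := Submodule.finrank_le N
    exact ⟨N, fun x hx y hy => (hN y).mp hy x hx, by omega⟩

section Padic

variable {p : ℕ} [Fact p.Prime]

lemma toZMod_eq_zero_iff (x : ℤ_[p]) : PadicInt.toZMod x = 0 ↔ (p : ℤ_[p]) ∣ x := by
  rw [← RingHom.mem_ker, PadicInt.ker_toZMod, PadicInt.maximalIdeal_eq_span_p,
    Ideal.mem_span_singleton]

/-- The unit `u` in `a = u * p ^ v(a)`. -/
def padicUnitPart (a : ℚ_[p]ˣ) : ℤ_[p]ˣ :=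
  PadicInt.mkUnits (u := (a : ℚ_[p]) * (p : ℚ_[p]) ^ (-(a : ℚ_[p]).valuation)) <| by
    have hp : (p : ℝ) ≠ 0 := by exact_mod_cast (Fact.out : p.Prime).ne_zero
    rw [norm_mul, Padic.norm_eq_zpow_neg_valuation a.ne_zero, norm_zpow, Padic.norm_p,
      inv_zpow', neg_neg, ← zpow_add₀ hp, neg_add_cancel, zpow_zero]

lemma padicUnitPart_coe (a : ℚ_[p]ˣ) : ((padicUnitPart a : ℤ_[p]) : ℚ_[p]) =
    a * (p : ℚ_[p]) ^ (-(a : ℚ_[p]).valuation) := rfl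

/-- An orthogonal complement argument for lattices: the reduction of a metabolic form over `ℚ_[p]`
is metabolic. -/
lemma halfIsotropic_reduction {ι : Type} [Fintype ι] (d : ι → Prop) [DecidablePred d]
    (u : ι → ℤ_[p]ˣ) (c : ι → ℚ_[p]ˣ)
    (hc : ∀ i, (p : ℚ_[p]) * c i = if d i then ((u i : ℤ_[p]) : ℚ_[p]) else
      (p : ℚ_[p]) * ((u i : ℤ_[p]) : ℚ_[p]))
    (h : HalfIsotropic (diagForm c)) :
    HalfIsotropic (diagForm fun i : {i // d i} =>
      Units.map (PadicInt.toZMod (p := p) : ℤ_[p] →* ZMod p) (u i)) := by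
  classical
  have hp0 : (p : ℚ_[p]) ≠ 0 := by exact_mod_cast (Fact.out : p.Prime).ne_zero
  obtain ⟨N, hN⟩ := (diagForm_halfIsotropic_iff c).mp h
  let co : (ι → ℤ_[p]) → (ι → ℚ_[p]) := fun y i => (y i : ℚ_[p])
  -- the integral coefficients of `p` times the form
  let k : ι → ℤ_[p] := fun i => if d i then (u i : ℤ_[p]) else p * u i
  have hk : ∀ i, (k i : ℚ_[p]) = p * c i := fun i => by
    rw [hc]; simp only [k]; split_ifs <;> simp
  have hpB : ∀ y w : ι → ℤ_[p], (p : ℚ_[p]) * diagForm c (co y) (co w) =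
      ((∑ i, k i * (y i * w i) : ℤ_[p]) : ℚ_[p]) := fun y w => by
    rw [diagForm_apply, Finset.mul_sum, PadicInt.coe_sum]
    refine Finset.sum_congr rfl fun i _ => ?_
    rw [PadicInt.coe_mul, hk, PadicInt.coe_mul]; simp only [co]; ring
  have hred : ∀ y w : ι → ℤ_[p], PadicInt.toZMod (∑ i, k i * (y i * w i)) =
      diagForm (fun i : {i // d i} =>
        Units.map (PadicInt.toZMod (p := p) : ℤ_[p] →* ZMod p) (u i))
        (fun i => PadicInt.toZMod (y i)) (fun i => PadicInt.toZMod (w i)) := fun y w => by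
    rw [diagForm_apply, map_sum]
    refine Eq.trans ?_ (Finset.sum_subtype (Finset.univ.filter d) (by simp)
      (fun i => PadicInt.toZMod (u i : ℤ_[p]) * (PadicInt.toZMod (y i) * PadicInt.toZMod (w i))))
    rw [Finset.sum_filter]
    refine Finset.sum_congr rfl fun i _ => ?_
    simp only [k]
    split_ifs <;> simp
  let P : Submodule ℤ_[p] (ι → ℤ_[p]) :=
    { carrier := {y | co y ∈ N}
      add_mem' := fun {y w} hy hw => by
        have : co (y + w) = co y + co w := by ext i; simp [co]
        simpa [this] using N.add_mem hy hw
      zero_mem' := by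
        have : co 0 = 0 := by ext i; simp [co]
        simp [this]
      smul_mem' := fun r y hy => by
        have : co (r • y) = (r : ℚ_[p]) • co y := by ext i; simp [co]
        simpa [this] using N.smul_mem _ hy }
  have hP : ∀ y, y ∈ P ↔ co y ∈ N := fun y => Iff.rfl
  -- `P` is a direct summand
  have htf : Module.IsTorsionFree ℤ_[p] ((ι → ℤ_[p]) ⧸ P) := by
    refine ⟨fun r hr => ?_⟩
    have hr0 : (r : ℚ_[p]) ≠ 0 := by simpa using hr.ne_zero
    rw [isSMulRegular_iff_right_eq_zero_of_smul]
    intro q hq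
    obtain ⟨y, rfl⟩ := P.mkQ_surjective q
    rw [← map_smul, Submodule.mkQ_apply, Submodule.Quotient.mk_eq_zero, hP] at hq
    rw [Submodule.mkQ_apply, Submodule.Quotient.mk_eq_zero, hP]
    have : co (r • y) = (r : ℚ_[p]) • co y := by ext i; simp [co]
    rw [this] at hq
    exact (N.smul_mem_iff hr0).mp hq
  have : Module.Free ℤ_[p] ((ι → ℤ_[p]) ⧸ P) := Module.free_of_finite_type_torsion_free'
  obtain ⟨s, hs⟩ := P.mkQ.exists_rightInverse_of_surjective P.range_mkQ
  let π : (ι → ℤ_[p]) →ₗ[ℤ_[p]] (ι → ℤ_[p]) := LinearMap.id - s ∘ₗ P.mkQ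
  have hπ : ∀ y, π y ∈ P := fun y => by
    rw [← Submodule.Quotient.mk_eq_zero, ← Submodule.mkQ_apply]
    have := LinearMap.congr_fun hs (P.mkQ y)
    simp only [LinearMap.comp_apply, LinearMap.id_apply] at this
    simp only [π, LinearMap.sub_apply, LinearMap.id_apply, LinearMap.comp_apply, map_sub, this,
      sub_self]
  have hπ' : ∀ y ∈ P, π y = y := fun y hy => by
    have : P.mkQ y = 0 := by simpa using hy
    simp [π, this]
  -- orthogonality to `P` is orthogonality to `N`
  have hden : ∀ z : ι → ℚ_[p], (∀ w ∈ P, diagForm c (co w) z = 0) → z ∈ N := fun z hz => by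
    rw [hN]
    intro w hw
    obtain ⟨b, hb⟩ := IsLocalization.exist_integer_multiples_of_finite (nonZeroDivisors ℤ_[p]) w
    choose y hy using hb
    have hy' : co y = ((b : ℤ_[p]) : ℚ_[p]) • w := by
      ext i
      have := hy i
      rw [PadicInt.algebraMap_apply] at this
      simp only [co, this, Pi.smul_apply, smul_eq_mul]
      rfl
    have h1 := hz y (by rw [hP, hy']; exact N.smul_mem _ hw)
    rw [hy', map_smul, LinearMap.smul_apply, smul_eq_mul, mul_eq_zero] at h1
    exact h1.resolve_left fun h0 => nonZeroDivisors.ne_zero b.2 (PadicInt.coe_eq_zero.mp h0)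
  rw [diagForm_halfIsotropic_iff]
  have hsurj : Function.Surjective (PadicInt.toZMod (p := p)) :=
    ZMod.ringHom_surjective _
  refine ⟨{ carrier := {m | ∃ y ∈ P, (fun i : {i // d i} => PadicInt.toZMod (y i)) = m}
            add_mem' := ?_, zero_mem' := ?_, smul_mem' := ?_ }, fun m => ⟨?_, fun hm => ?_⟩⟩
  · rintro _ _ ⟨y, hy, rfl⟩ ⟨w, hw, rfl⟩
    exact ⟨y + w, P.add_mem hy hw, by ext i; simp⟩
  · exact ⟨0, P.zero_mem, by ext i; simp⟩
  · rintro r _ ⟨y, hy, rfl⟩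
    obtain ⟨r, rfl⟩ := hsurj r
    exact ⟨r • y, P.smul_mem r hy, by ext i; simp⟩
  · rintro ⟨y, hy, rfl⟩ _ ⟨w, hw, rfl⟩
    have h0 := hpB w y
    rw [(hN _).mp hy _ hw, mul_zero] at h0
    rw [← hred, PadicInt.coe_eq_zero.mp h0.symm, map_zero]
  · have hsurj' := hsurj
    choose f hf using hsurj'
    let z : ι → ℤ_[p] := fun i => if h : d i then f (m ⟨i, h⟩) else 0
    have hz : (fun i : {i // d i} => PadicInt.toZMod (z i)) = m := by
      ext i; simp [z, i.2, hf]
    have hint : ∀ w ∈ P, ∃ r : ℤ_[p], (r : ℚ_[p]) = diagForm c (co w) (co z) := fun w hw => by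
      have h0 := hm _ ⟨w, hw, rfl⟩
      rw [← hz, ← hred, toZMod_eq_zero_iff] at h0
      obtain ⟨r, hr⟩ := h0
      refine ⟨r, mul_left_cancel₀ hp0 ?_⟩
      rw [hpB, hr]; simp
    choose g hg using fun i => hint (π (Pi.single i 1)) (hπ _)
    have hexp : ∀ w ∈ P, diagForm c (co w) (co z) = ∑ i, (g i : ℚ_[p]) * w i := fun w hw => by
      have h1 : w = ∑ i, w i • π (Pi.single i 1) := by
        conv_lhs => rw [← hπ' w hw, pi_eq_sum_univ' w, map_sum]
        exact Finset.sum_congr rfl fun i _ => by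
          rw [map_smul]
      have h2 : co w = ∑ i, (w i : ℚ_[p]) • co (π (Pi.single i 1)) := by
        ext j
        have := congrFun h1 j
        rw [Finset.sum_apply] at this ⊢
        simp only [co]
        rw [this, PadicInt.coe_sum]
        simp
      rw [h2, map_sum, LinearMap.sum_apply]
      refine Finset.sum_congr rfl fun i _ => ?_
      rw [map_smul, LinearMap.smul_apply, ← hg, smul_eq_mul, mul_comm]
    let z' : ι → ℤ_[p] := fun i => (if d i then (p : ℤ_[p]) else 1) * ((u i)⁻¹ : ℤ_[p]ˣ) * g i
    have hz' : ∀ i, (c i : ℚ_[p]) * z' i = g i := fun i => by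
      have h1 : k i * z' i = (p : ℤ_[p]) * g i := by
        simp only [k, z']
        split_ifs <;> linear_combination (p : ℤ_[p]) * g i * (u i).mul_inv
      refine mul_left_cancel₀ hp0 ?_
      rw [← mul_assoc, ← hk, ← PadicInt.coe_mul, h1]
      simp
    have hmem : z - z' ∈ P := by
      rw [hP]
      refine hden _ fun w hw => ?_
      have : co (z - z') = co z - co z' := by ext i; simp [co]
      rw [this, map_sub, hexp w hw, diagForm_apply, sub_eq_zero]
      refine Finset.sum_congr rfl fun i _ => ?_
      rw [← hz']; simp only [co]; ring
    refine ⟨z - z', hmem, ?_⟩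
    rw [← hz]
    ext i
    simp [z', i.2]

/-- The second residue of `[a]` with respect to the uniformizer `p`: for `a = u * p ^ v` with a unit
`u`, it is `0` if `v` is even and the class of `u` modulo `p` if `v` is odd. -/
def padicResidueUnit (a : ℚ_[p]ˣ) : WittGroup (ZMod p) :=
  open Classical in
  if Odd (a : ℚ_[p]).valuation then
    WittGroup.unit (Units.map (PadicInt.toZMod (p := p) : ℤ_[p] →* ZMod p) (padicUnitPart a))
  else 0

lemma padicResidueUnit_killsMetabolic :
    WittGroup.KillsMetabolic (padicResidueUnit (p := p)) := by
  classical
  intro ι _ a h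
  have hp0 : (p : ℚ_[p]) ≠ 0 := by exact_mod_cast (Fact.out : p.Prime).ne_zero
  let d : ι → Prop := fun i => Odd (a i : ℚ_[p]).valuation
  let t : ι → ℚ_[p]ˣ := fun i => Units.mk0 (p : ℚ_[p]) hp0 ^ (((a i : ℚ_[p]).valuation + 1) / 2)
  let c : ι → ℚ_[p]ˣ := fun i => a i * (t i)⁻¹ ^ 2
  have hc : ∀ i, (p : ℚ_[p]) * c i = if d i then ((padicUnitPart (a i) : ℤ_[p]) : ℚ_[p]) else
      (p : ℚ_[p]) * ((padicUnitPart (a i) : ℤ_[p]) : ℚ_[p]) := fun i => by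
    simp only [padicUnitPart_coe, d, c, t]
    push_cast
    rw [Units.val_mk0, ← zpow_neg, ← zpow_natCast, ← zpow_mul]
    split_ifs with ho
    · obtain ⟨r, hr⟩ := ho
      rw [hr, show (2 * r + 1 + 1) / 2 = r + 1 by omega, mul_left_comm, ← zpow_one_add₀ hp0]
      congr 2; push_cast; ring
    · obtain ⟨r, hr⟩ := Int.not_odd_iff_even.mp ho
      rw [hr, show (r + r + 1) / 2 = r by omega]
      congr 3; push_cast; ring
  have h1 : HalfIsotropic (diagForm c) := by
    have h' : HalfIsotropic (diagForm a) := h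
    refine h'.congr
      (LinearEquiv.piCongrRight fun i => LinearEquiv.smulOfUnit (t i)) fun x y => ?_
    rw [diagForm_apply, diagForm_apply]
    refine Finset.sum_congr rfl fun i _ => ?_
    have : ((t i)⁻¹ : ℚ_[p]ˣ).val * (t i).val = 1 := (t i).inv_mul
    change ((c i : ℚ_[p]ˣ) : ℚ_[p]) * ((t i : ℚ_[p]) * x i * ((t i : ℚ_[p]) * y i)) = _
    simp only [c, Units.val_mul, Units.val_pow_eq_pow_val]
    linear_combination (a i : ℚ_[p]) * x i * y i * (((t i)⁻¹ : ℚ_[p]ˣ).val * (t i).val + 1) * this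
  have h2 := WittGroup.mk_eq_zero (A := SymForm.diag _)
    (halfIsotropic_reduction d (fun i => padicUnitPart (a i)) c hc h1)
  rw [SymForm.mk_diag] at h2
  rw [← h2, ← Finset.sum_subtype (Finset.univ.filter d) (by simp)
      (fun i => WittGroup.unit (Units.map (PadicInt.toZMod (p := p) : ℤ_[p] →* ZMod p)
        (padicUnitPart (a i)))), Finset.sum_filter]
  rfl

end Padic

namespace WittGroup

variable (p : ℕ) [Fact p.Prime]

/-- The second residue homomorphism `W(ℚ_p) → W(𝔽_p)` for the uniformizer `p`. -/
def padicResidue : WittGroup ℚ_[p] →+ WittGroup (ZMod p) :=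
  lift two_ne_zero padicResidueUnit padicResidueUnit_killsMetabolic

/-- The homomorphism `∂_p : W(ℚ) → W(𝔽_p)`. -/
def residue : WittGroup ℚ →+ WittGroup (ZMod p) :=
  (padicResidue p).comp (baseChange ℚ_[p])

end WittGroup

instance fact_prime_primes (q : Nat.Primes) : Fact (q : ℕ).Prime := ⟨q.2⟩

namespace WittGroup

/-- The homomorphism `∂ = (∂_q)_q` to the Witt groups of all prime fields. Its values have finite
support, so equality in the product is equality in the direct sum. -/
def boundary : WittGroup ℚ →+ ((q : Nat.Primes) → WittGroup (ZMod q)) :=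
  AddMonoidHom.mk' (fun w q => residue q w) fun _ _ => funext fun _ => map_add _ _ _

/-- The Witt span of a class `w`: the least rank of a form `B` with `∂ [B] = ∂ w`. -/
def wittSpan (w : WittGroup ℚ) : ℕ :=
  sInf {n | ∃ B : SymForm ℚ, B.rank = n ∧ boundary (mk B) = boundary w}

end WittGroup

/-! Singular homology in degree one. -/

section Homology

variable (X : Type) [TopologicalSpace X]

/-- The edge `t ↦ (1 - t) eᵢ + t eⱼ` of the standard 2-simplex. -/
def simplexEdge (i j : Fin 3) : C(unitInterval, stdSimplex ℝ (Fin 3)) where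
  toFun t := ⟨(1 - (t : ℝ)) • Pi.single i 1 + (t : ℝ) • Pi.single j 1,
    convex_stdSimplex ℝ (Fin 3) (single_mem_stdSimplex ℝ i) (single_mem_stdSimplex ℝ j)
      (sub_nonneg.mpr t.2.2) t.2.1 (by ring)⟩
  continuous_toFun := by fun_prop

/-- The boundary map from singular 1-chains to singular 0-chains. -/
def singularBoundary₁ : (C(unitInterval, X) →₀ ℤ) →ₗ[ℤ] (X →₀ ℤ) :=
  Finsupp.linearCombination ℤ fun σ => Finsupp.single (σ 1) 1 - Finsupp.single (σ 0) 1

/-- The boundary map from singular 2-chains to singular 1-chains. -/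
def singularBoundary₂ : (C(stdSimplex ℝ (Fin 3), X) →₀ ℤ) →ₗ[ℤ] (C(unitInterval, X) →₀ ℤ) :=
  Finsupp.linearCombination ℤ fun τ =>
    Finsupp.single (τ.comp (simplexEdge 1 2)) 1 - Finsupp.single (τ.comp (simplexEdge 0 2)) 1 +
      Finsupp.single (τ.comp (simplexEdge 0 1)) 1

/-- The first singular homology group `H₁(X; ℤ)`. -/
abbrev SingularH₁ : Type :=
  LinearMap.ker (singularBoundary₁ X) ⧸
    (LinearMap.range (singularBoundary₂ X)).submoduleOf (LinearMap.ker (singularBoundary₁ X))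

variable {X}

/-- The homology class of a loop. -/
def loopClass (σ : C(unitInterval, X)) (h : σ 0 = σ 1) : SingularH₁ X :=
  Submodule.Quotient.mk ⟨Finsupp.single σ 1, by simp [singularBoundary₁, h]⟩

end Homology

/-! Knots, Seifert surfaces and the Witt class. -/

open scoped ContDiff

/-- Euclidean 3-space. -/
abbrev E3 : Type := EuclideanSpace ℝ (Fin 3)

/-- A knot: a smoothly embedded circle, parametrized with period `1`. -/
structure Knot where
  toFun : ℝ → E3
  smooth : ContDiff ℝ ∞ toFun
  periodic : Function.Periodic toFun 1
  injOn : Set.InjOn toFun (Set.Ico 0 1)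
  immersed : ∀ t, deriv toFun t ≠ 0

/-- The underlying set of a knot. -/
def Knot.image (K : Knot) : Set E3 := Set.range K.toFun

/-- A diffeomorphism between open subsets of 3-space. -/
def IsSmoothChart (φ : OpenPartialHomeomorph E3 E3) : Prop :=
  ContDiffOn ℝ ∞ φ φ.source ∧ ContDiffOn ℝ ∞ φ.symm φ.target

/-- A Seifert surface of `K`: a compact connected smooth surface embedded in 3-space, with boundary
`K`, oriented by a continuous field of unit normal vectors. Near a point off `K` the surface is
straightened to the plane `x₂ = 0`, near a point of `K` to the half-plane `x₂ = 0 ≤ x₁`, with `K`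
going to the edge of the half-plane. Which of the two orientations is taken does not matter for the
symmetrized Seifert form, so none is singled out by `K`. -/
structure SeifertSurface (K : Knot) where
  carrier : Set E3
  isCompact : IsCompact carrier
  isConnected : IsConnected carrier
  boundary_subset : K.image ⊆ carrier
  normal : E3 → E3
  continuousOn_normal : ContinuousOn normal carrier
  norm_normal : ∀ x ∈ carrier, ‖normal x‖ = 1
  exists_chart : ∀ x ∈ carrier, ∃ φ : OpenPartialHomeomorph E3 E3, IsSmoothChart φ ∧ x ∈ φ.source ∧
    (∀ v : E3, (fderiv ℝ φ x v) 2 = 0 → inner ℝ (normal x) v = 0) ∧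
    ((x ∉ K.image ∧ ∀ y ∈ φ.source, y ∈ carrier ↔ φ y 2 = 0) ∨
      (x ∈ K.image ∧ ∀ y ∈ φ.source, (y ∈ carrier ↔ φ y 2 = 0 ∧ 0 ≤ φ y 1) ∧
        (y ∈ K.image ↔ φ y 2 = 0 ∧ φ y 1 = 0)))

/-- Gauss's integral for the linking number of two disjoint smooth closed curves of period `1`. -/
def linkingNumber (a c : ℝ → E3) : ℝ :=
  (4 * Real.pi)⁻¹ * ∫ s in (0 : ℝ)..1, ∫ t in (0 : ℝ)..1,
    Matrix.det (Matrix.of fun i j : Fin 3 => (![a s - c t, deriv a s, deriv c t] i) j) /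
      ‖a s - c t‖ ^ 3

/-- A smooth closed curve, of period `1`, on a subset of 3-space. -/
structure SmoothLoop (S : Set E3) where
  toFun : ℝ → E3
  smooth : ContDiff ℝ ∞ toFun
  periodic : Function.Periodic toFun 1
  mem : ∀ t, toFun t ∈ S

namespace SmoothLoop

variable {S : Set E3} (a : SmoothLoop S)

/-- The loop as a singular 1-simplex. -/
def toSimplex : C(unitInterval, S) where
  toFun t := ⟨a.toFun t, a.mem t⟩
  continuous_toFun := by
    have := a.smooth.continuous
    fun_prop

/-- The homology class of the loop. -/
def homologyClass : SingularH₁ S :=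
  loopClass a.toSimplex <| Subtype.ext <| by
    simpa [toSimplex] using (a.periodic 0).symm

end SmoothLoop

namespace SeifertSurface

variable {K : Knot} (S : SeifertSurface K)

/-- The push-off of a curve on the surface by `ε` in the positive normal direction. -/
def pushOff (ε : ℝ) (b : SmoothLoop S.carrier) : ℝ → E3 :=
  fun t => b.toFun t + ε • S.normal (b.toFun t)

/-- `V` is the Seifert form of the surface: `V(α, β) = lk(a, b⁺)` for curves `a`, `b` on the surface
that represent `α`, `β` and a small positive push-off `b⁺` of `b`. As curves generate the homology
group, this determines `V`. -/
def IsSeifertForm (V : LinearMap.BilinForm ℤ (SingularH₁ S.carrier)) : Prop :=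
  ∀ a b : SmoothLoop S.carrier, ∀ᶠ ε in nhdsWithin (0 : ℝ) (Set.Ioi 0),
    (V a.homologyClass b.homologyClass : ℝ) = linkingNumber a.toFun (S.pushOff ε b)

end SeifertSurface

/-- `w` is the Witt class of `K`: for a Seifert surface `S` of `K` with Seifert form `V`, it is the
class of the extension of `V + Vᵀ` to `ℚ ⊗ H₁(S; ℤ) = H₁(S; ℚ)`. -/
def Knot.IsWittClass (K : Knot) (w : WittGroup ℚ) : Prop :=
  ∃ (S : SeifertSurface K) (V : LinearMap.BilinForm ℤ (SingularH₁ S.carrier)) (A : SymForm ℚ)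
    (e : A.V ≃ₗ[ℚ] ℚ ⊗[ℤ] SingularH₁ S.carrier),
    S.IsSeifertForm V ∧ (∀ x y, (V + V.flip).baseChange ℚ (e x) (e y) = A.B x y) ∧
      w = WittGroup.mk A

end

/-!
A rational number is `±` a square as soon as all its `q`-adic valuations are even, so a form of rank
one over `ℚ` is determined up to sign by the parities of the ranks of its residues. Signs are
invisible over `𝔽_p`, where `-1` is a square. Hence a form of rank one whose residues away from `p`
have even rank has residue `0` or that of `⟨p⟩`, namely `[1] ≠ [β]`, at `p`. If all residues of
`⟨a⟩ ⊕ ⟨b⟩` have even rank, then `⟨a⟩` and `⟨b⟩` have the same residue at `p`, and the two cancel.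

Conversely, for a prime `r ≡ 3 mod 4` with `r ≡ β mod p`, the form `⟨pr⟩ ⊕ ⟨r⟩` has residue `[β]` at
`p` and `[p] + [1]` at `r`. The latter vanishes, since `-p` is a square modulo `r` by quadratic
reciprocity. Adding `⟨p⟩` gives the residue `[1] + [β]` at `p`.
-/

namespace SymForm

variable {F : Type} [Field F]

lemma isRefl (A : SymForm F) : A.B.IsRefl := fun x y hxy => by rw [A.symm, hxy]

lemma nondegenerate (A : SymForm F) : A.B.Nondegenerate :=
  A.isRefl.nondegenerate_iff_separatingLeft.mpr A.nondeg

lemma metabolic_iff_exists_orthogonal_eq_self {A : SymForm F} :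
    A.Metabolic ↔ ∃ N, A.B.orthogonal N = N := by
  refine exists_congr fun N => ⟨fun ⟨hN, hd⟩ => ?_, fun hN => ⟨fun x hx y hy => ?_, ?_⟩⟩
  · have hle : N ≤ A.B.orthogonal N := fun z hz w hw => hN w hw z hz
    refine (Submodule.eq_of_le_of_finrank_eq hle ?_).symm
    rw [LinearMap.BilinForm.finrank_orthogonal A.nondegenerate, hd]
    lia
  · rw [← hN] at hy
    exact hy x hx
  · have hd := LinearMap.BilinForm.finrank_orthogonal A.nondegenerate N
    have hle := Submodule.finrank_le N
    rw [hN] at hd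
    lia

lemma metabolic_iff_exists_isotropic {A : SymForm F} (hA : A.rank = 2) :
    A.Metabolic ↔ ∃ v ≠ 0, A.B v v = 0 := by
  constructor
  · rintro ⟨N, hN, hd⟩
    have hN0 : N ≠ ⊥ := by
      rintro rfl
      rw [finrank_bot] at hd
      exact two_ne_zero (hA.symm.trans hd)
    obtain ⟨v, hv, hv0⟩ := N.exists_mem_ne_zero_of_ne_bot hN0
    exact ⟨v, hv0, hN v hv v hv⟩
  · rintro ⟨v, hv0, hv⟩
    refine ⟨F ∙ v, fun x hx y hy => ?_, ?_⟩
    · obtain ⟨r, rfl⟩ := Submodule.mem_span_singleton.mp hx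
      obtain ⟨s, rfl⟩ := Submodule.mem_span_singleton.mp hy
      simp only [map_smul, LinearMap.smul_apply, hv, smul_zero]
    · rw [finrank_span_singleton hv0]
      exact hA

lemma oplus_orthogonal_map_inr (A M : SymForm F) (N : Submodule F M.V) :
    (A.oplus M).B.orthogonal (N.map (LinearMap.inr F A.V M.V)) =
      (M.B.orthogonal N).comap (LinearMap.snd F A.V M.V) := by
  ext z
  have oplus_inr (n : M.V) : (A.oplus M).B (LinearMap.inr F A.V M.V n) z = M.B n z.2 := by
    change A.B 0 z.1 + M.B n z.2 = M.B n z.2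
    rw [map_zero, LinearMap.zero_apply, zero_add]
  refine ⟨fun hz n hn => ?_, ?_⟩
  · exact (oplus_inr n).symm.trans (hz _ (Submodule.mem_map_of_mem hn))
  · rintro hz _ ⟨n, hn, rfl⟩
    exact (oplus_inr n).trans (hz n hn)

lemma Metabolic.of_oplus {A M : SymForm F} (h : (A.oplus M).Metabolic) (hM : M.Metabolic) :
    A.Metabolic := by
  rw [metabolic_iff_exists_orthogonal_eq_self] at h hM ⊢
  obtain ⟨L, hL⟩ := h
  obtain ⟨N, hN⟩ := hM
  let N₀ : Submodule F (A.oplus M).V := N.map (LinearMap.inr F A.V M.V)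
  let K : Submodule F A.V := (L ⊓ N.comap (LinearMap.snd F A.V M.V)).map (LinearMap.fst F A.V M.V)
  refine ⟨K, le_antisymm (fun x hx => ?_) ?_⟩
  · let x₀ : (A.oplus M).V := (x, 0)
    have hx₀ : x₀ ∈ L ⊔ N₀ := by
      rw [← LinearMap.BilinForm.orthogonal_orthogonal (A.oplus M).nondegenerate
        (A.oplus M).isRefl (L ⊔ N₀)]
      intro z hz
      have hzL : z ∈ L := hL ▸ LinearMap.BilinForm.orthogonal_le le_sup_left hz
      have hzN : z ∈ N.comap (LinearMap.snd F A.V M.V) := by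
        rw [← hN, ← oplus_orthogonal_map_inr]
        exact LinearMap.BilinForm.orthogonal_le le_sup_right hz
      have hxz : A.B z.1 x = 0 := hx z.1 ⟨z, ⟨hzL, hzN⟩, rfl⟩
      change A.B z.1 x + M.B z.2 0 = 0
      rw [hxz, map_zero, add_zero]
    obtain ⟨l, hl, _, ⟨n, hn, rfl⟩, hln⟩ := Submodule.mem_sup.mp hx₀
    obtain ⟨h₁, h₂⟩ : l.1 + 0 = x ∧ l.2 + n = 0 := Prod.ext_iff.mp hln
    have hlN : l.2 ∈ N := eq_neg_of_add_eq_zero_left h₂ ▸ N.neg_mem hn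
    exact ⟨l, ⟨hl, hlN⟩, (add_zero l.1).symm.trans h₁⟩
  · rintro _ ⟨z, ⟨hzL, hzN⟩, rfl⟩ _ ⟨w, ⟨hwL, hwN⟩, rfl⟩
    have hwz : A.B w.1 z.1 + M.B w.2 z.2 = 0 := by
      rw [← hL] at hzL
      exact hzL w hwL
    have hwz₂ : M.B w.2 z.2 = 0 := by
      rw [← hN] at hzN
      exact hzN w.2 hwN
    rwa [hwz₂, add_zero] at hwz

lemma rank_oplus (A B : SymForm F) : (A.oplus B).rank = A.rank + B.rank := Module.finrank_prod

lemma rank_rankOne (a : Fˣ) : (rankOne a).rank = 1 := Module.finrank_self F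

lemma Metabolic.even_rank {A : SymForm F} : A.Metabolic → Even A.rank :=
  fun ⟨_, _, hd⟩ => even_iff_two_dvd.mpr ⟨_, hd⟩

lemma isometric_neg_of_isSquare_neg_one (h : IsSquare (-1 : F)) (A : SymForm F) :
    A.Isometric A.neg := by
  obtain ⟨i, hi⟩ := h
  have hi0 : i ≠ 0 := by
    rintro rfl
    simp at hi
  refine ⟨LinearEquiv.smulOfNeZero F A.V i hi0, fun x y => ?_⟩
  change -A.B (i • x) (i • y) = A.B x y
  simp only [map_smul, LinearMap.smul_apply, smul_smul, ← hi, neg_smul, one_smul, neg_neg]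

end SymForm

namespace WittGroup

section Field

variable {F : Type} [Field F]

lemma mk_rankOne (a : Fˣ) : mk (SymForm.rankOne a) = unit a := rfl

lemma mk_eq_zero_iff {A : SymForm F} : mk A = 0 ↔ A.Metabolic := by
  refine ⟨fun h => ?_, mk_eq_zero⟩
  obtain ⟨M, N, hM, hN, h⟩ : A.WittEquiv (SymForm.zero F) := Quotient.exact h
  exact ((SymForm.metabolic_zero.oplus hN).of_isometric h.symm).of_oplus hM

lemma neg_eq_self (h : IsSquare (-1 : F)) (w : WittGroup F) : -w = w := by
  obtain ⟨A, rfl⟩ := Quotient.exists_rep w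
  exact (mk_eq_of_isometric (A.isometric_neg_of_isSquare_neg_one h)).symm

lemma unit_neg (a : Fˣ) : unit (-a) = -unit a := by
  refine mk_eq_of_isometric ⟨LinearEquiv.refl F F, fun (x y : F) => ?_⟩
  change -((a : F) * (x * y)) = ((-a : Fˣ) : F) * (x * y)
  rw [Units.val_neg, neg_mul]

lemma unit_add_unit_eq_zero_iff (a b : Fˣ) :
    unit a + unit b = 0 ↔ IsSquare (-(a * b) : F) := by
  have hrank : ((SymForm.rankOne a).oplus (SymForm.rankOne b)).rank = 2 := by
    rw [SymForm.rank_oplus, SymForm.rank_rankOne, SymForm.rank_rankOne]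
  rw [← mk_rankOne, ← mk_rankOne, ← mk_oplus, mk_eq_zero_iff,
    SymForm.metabolic_iff_exists_isotropic hrank]
  constructor
  · rintro ⟨v, hv, h⟩
    obtain ⟨x, y⟩ : F × F := v
    change (a : F) * (x * x) + b * (y * y) = 0 at h
    have hy : y ≠ 0 := by
      rintro rfl
      have hx : x = 0 := by simpa using h
      exact hv (Prod.ext hx rfl)
    refine ⟨a * x / y, ?_⟩
    field_simp
    linear_combination -h
  · rintro ⟨c, hc⟩
    refine ⟨((b : F), c), fun h => b.ne_zero (congrArg Prod.fst h), ?_⟩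
    change (a : F) * (b * b) + b * (c * c) = 0
    linear_combination (-b : F) * hc

lemma unit_eq_unit_iff (a b : Fˣ) : unit a = unit b ↔ IsSquare (a * b : F) := by
  rw [← sub_eq_zero, sub_eq_add_neg, ← unit_neg, unit_add_unit_eq_zero_iff, Units.val_neg,
    mul_neg, neg_neg]

lemma unit_one_add_unit_ne_zero (hF : IsSquare (-1 : F)) {a : Fˣ}
    (ha : ¬ IsSquare (a : F)) : unit 1 + unit a ≠ 0 := by
  rwa [Ne, ← neg_eq_self hF (unit a), ← sub_eq_add_neg, sub_eq_zero, unit_eq_unit_iff,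
    Units.val_one, one_mul]

variable (F) in
/-- The rank of a form modulo two, which is a Witt invariant since metabolic forms have even
rank. -/
noncomputable def rankParity : WittGroup F →+ ZMod 2 :=
  AddMonoidHom.mk'
    (Quotient.lift (fun A : SymForm F => (A.rank : ZMod 2)) <| by
      rintro A B ⟨M, N, hM, hN, ⟨e, _⟩⟩
      have hrank : A.rank + M.rank = B.rank + N.rank := by
        rw [← SymForm.rank_oplus, ← SymForm.rank_oplus]
        exact e.finrank_eq
      simpa [ZMod.natCast_eq_zero_iff_even.mpr hM.even_rank,
        ZMod.natCast_eq_zero_iff_even.mpr hN.even_rank] using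
        congrArg (Nat.cast : ℕ → ZMod 2) hrank) <| by
    rintro ⟨A⟩ ⟨B⟩
    exact (congrArg Nat.cast (A.rank_oplus B)).trans (Nat.cast_add _ _)

lemma rankParity_mk (A : SymForm F) : rankParity F (mk A) = A.rank := rfl

@[simp] lemma rankParity_unit (a : Fˣ) : rankParity F (unit a) = 1 := by
  rw [← mk_rankOne, rankParity_mk, SymForm.rank_rankOne, Nat.cast_one]

lemma mk_eq_sum_unit (h2 : (2 : F) ≠ 0) (A : SymForm F) :
    ∃ a : Fin A.rank → Fˣ, mk A = ∑ i, unit (a i) := by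
  obtain ⟨a, ha⟩ := A.exists_diag h2
  exact ⟨a, (mk_eq_of_isometric ha).trans (SymForm.mk_diag a)⟩

end Field

end WittGroup

lemma isSquare_of_forall_even_padicValNat {n : ℕ}
    (h : ∀ (q : ℕ) [Fact q.Prime], Even (padicValNat q n)) : IsSquare n := by
  rcases eq_or_ne n 0 with rfl | hn
  · exact IsSquare.zero
  rw [← Nat.prod_factorization_pow_eq_self hn]
  refine Finset.isSquare_prod _ fun q hq => ?_
  have : Fact q.Prime := ⟨Nat.prime_of_mem_primeFactors hq⟩
  rw [Nat.factorization_def n Fact.out]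
  exact (h q).isSquare_pow q

lemma isSquare_or_isSquare_neg_of_forall_even_padicValRat {a : ℚ} (ha : a ≠ 0)
    (h : ∀ (q : ℕ) [Fact q.Prime], Even (padicValRat q a)) : IsSquare a ∨ IsSquare (-a) := by
  have hsq : IsSquare (a.num.natAbs * a.den) := by
    refine isSquare_of_forall_even_padicValNat fun q _ => ?_
    rw [padicValNat.mul (Int.natAbs_ne_zero.mpr (Rat.num_ne_zero.mpr ha)) a.den_ne_zero]
    have hq := h q
    rw [padicValRat_def, Int.even_sub, Int.even_coe_nat, Int.even_coe_nat] at hq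
    exact Nat.even_add.mpr hq
  have habs : IsSquare |a| := by
    have habs_eq : |a| = (a.num.natAbs * a.den : ℕ) / (a.den * a.den) := by
      rw [Rat.abs_def, Rat.divInt_eq_div]
      have hden : (a.den : ℚ) ≠ 0 := Nat.cast_ne_zero.mpr a.den_ne_zero
      rw [Nat.cast_mul, mul_div_mul_right _ _ hden, Int.cast_natCast, Int.cast_natCast]
    rw [habs_eq]
    exact (Rat.isSquare_natCast_iff.mpr hsq).div (IsSquare.mul_self _)
  rcases abs_choice a with h' | h' <;> rw [h'] at habs
  · exact .inl habs
  · exact .inr habs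

lemma isSquare_mul_of_not_isSquare {F : Type*} [Field F] [Finite F] {a b : F}
    (ha : ¬ IsSquare a) (hb : ¬ IsSquare b) : IsSquare (a * b) := by
  classical
  have := Fintype.ofFinite F
  have hab : a * b ≠ 0 :=
    mul_ne_zero (by rintro rfl; exact ha .zero) (by rintro rfl; exact hb .zero)
  rw [← quadraticChar_one_iff_isSquare hab, map_mul,
    quadraticChar_neg_one_iff_not_isSquare.mpr ha, quadraticChar_neg_one_iff_not_isSquare.mpr hb,
    neg_one_mul, neg_neg]

lemma exists_prime_modEq_and_modEq {m n a b : ℕ} (hm : m ≠ 0) (hn : n ≠ 0) (hmn : m.Coprime n)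
    (ha : a.Coprime m) (hb : b.Coprime n) :
    ∃ r : ℕ, r.Prime ∧ r ≡ a [MOD m] ∧ r ≡ b [MOD n] := by
  obtain ⟨k, hka, hkb⟩ := Nat.chineseRemainder hmn a b
  have hk : k.Coprime (m * n) :=
    Nat.Coprime.mul_right (hka.gcd_eq.trans ha) (hkb.gcd_eq.trans hb)
  obtain ⟨r, -, hr, hrk⟩ := Nat.forall_exists_prime_gt_and_modEq 0 (mul_ne_zero hm hn) hk
  exact ⟨r, hr, (hrk.of_mul_right n).trans hka, (hrk.of_mul_left m).trans hkb⟩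

lemma exists_prime_eq_and_isSquare_neg {p : ℕ} [Fact p.Prime] (hp : p % 4 = 1) {β : (ZMod p)ˣ}
    (hβ : ¬ IsSquare (β : ZMod p)) :
    ∃ r : ℕ, r.Prime ∧ (r : ZMod p) = β ∧ IsSquare (-p : ZMod r) := by
  have h4p : Nat.Coprime 4 p := by
    rw [Nat.Coprime, Nat.gcd_rec, hp, Nat.gcd_one_left]
  obtain ⟨r, hr, hr4, hrβ⟩ := exists_prime_modEq_and_modEq four_ne_zero (NeZero.ne p) h4p
    (by norm_num : Nat.Coprime 3 4) (ZMod.val_coe_unit_coprime β)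
  have : Fact r.Prime := ⟨hr⟩
  have hr4 : r % 4 = 3 := hr4
  have hrp : (r : ZMod p) = β := by
    rw [(ZMod.natCast_eq_natCast_iff _ _ _).mpr hrβ, ZMod.natCast_zmod_val]
  refine ⟨r, hr, hrp, ?_⟩
  have hneg_one : ¬ IsSquare (-1 : ZMod r) := fun h => ZMod.exists_sq_eq_neg_one_iff.mp h hr4
  have hp_nonsquare : ¬ IsSquare (p : ZMod r) := by
    rwa [← ZMod.exists_sq_eq_prime_iff_of_mod_four_eq_one hp (by lia), hrp]
  rw [← neg_one_mul]
  exact isSquare_mul_of_not_isSquare hneg_one hp_nonsquare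

/-- A prime number as an element of `ℚˣ`. -/
noncomputable def primeUnit (p : ℕ) [Fact p.Prime] : ℚˣ :=
  Units.mk0 (p : ℚ) (Nat.cast_ne_zero.mpr (NeZero.ne p))

@[simp] lemma coe_primeUnit (p : ℕ) [Fact p.Prime] : (primeUnit p : ℚ) = p := rfl

lemma padicValRat_primeUnit_of_ne {p q : ℕ} [Fact p.Prime] [Fact q.Prime] (h : q ≠ p) :
    padicValRat q (primeUnit p) = 0 := by
  rw [coe_primeUnit, padicValRat.of_nat, padicValNat_primes h, Nat.cast_zero]

lemma padicInt_valuation_unit {p : ℕ} [Fact p.Prime] (u : ℤ_[p]ˣ) : (u : ℤ_[p]).valuation = 0 := by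
  have h := PadicInt.valuation_mul u.ne_zero u⁻¹.ne_zero
  rw [Units.mul_inv, PadicInt.valuation_one] at h
  lia

namespace WittGroup

open scoped TensorProduct in
lemma baseChange_unit {F : Type} [Field F] (L : Type) [Field L] [Algebra F L] (a : Fˣ) :
    baseChange L (unit a) = unit (Units.map (algebraMap F L : F →* L) a) := by
  refine mk_eq_of_isometric ⟨TensorProduct.AlgebraTensorModule.rid F L L,
    fun (x y : L ⊗[F] F) => ?_⟩
  change algebraMap F L a * (TensorProduct.AlgebraTensorModule.rid F L L x *
    TensorProduct.AlgebraTensorModule.rid F L L y) =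
    LinearMap.BilinForm.baseChange L ((a : F) • LinearMap.mul F F) x y
  induction x using TensorProduct.induction_on with
  | zero => simp only [map_zero, zero_mul, mul_zero, LinearMap.zero_apply]
  | add x x' hx hx' => simp only [map_add, LinearMap.add_apply, add_mul, mul_add, hx, hx']
  | tmul l n =>
    induction y using TensorProduct.induction_on with
    | zero => simp only [map_zero, mul_zero]
    | add y y' hy hy' => rw [map_add, map_add, mul_add, mul_add, hy, hy']
    | tmul l' n' => simp [Algebra.smul_def]; ring

section Residue

variable (p : ℕ) [Fact p.Prime]

lemma residue_unit (a : ℚˣ) : residue p (unit a) =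
    padicResidueUnit (Units.map (algebraMap ℚ ℚ_[p] : ℚ →* ℚ_[p]) a) := by
  rw [residue, AddMonoidHom.comp_apply, baseChange_unit, padicResidue, lift_unit]

lemma residue_unit_of_even {a : ℚˣ} (h : Even (padicValRat p a)) : residue p (unit a) = 0 := by
  rw [residue_unit, padicResidueUnit, if_neg]
  simpa using h

lemma exists_residue_unit_of_odd {a : ℚˣ} (h : Odd (padicValRat p a)) :
    ∃ u : (ZMod p)ˣ, residue p (unit a) = unit u := by
  rw [residue_unit, padicResidueUnit, if_pos]
  · exact ⟨_, rfl⟩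
  · simpa using h

lemma rankParity_residue_unit (a : ℚˣ) :
    rankParity _ (residue p (unit a)) = (padicValRat p a : ZMod 2) := by
  rcases Int.even_or_odd (padicValRat p a) with h | h
  · rw [residue_unit_of_even p h, map_zero, ZMod.intCast_eq_zero_iff_even.mpr h]
  · obtain ⟨u, hu⟩ := exists_residue_unit_of_odd p h
    rw [hu, rankParity_unit, ZMod.intCast_eq_one_iff_odd.mpr h]

variable {p}

lemma padicResidueUnit_of_eq_prime_mul {x : ℚ_[p]ˣ} {u : ℤ_[p]ˣ}
    (h : (x : ℚ_[p]) = p * (u : ℤ_[p])) :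
    padicResidueUnit x = unit (Units.map (PadicInt.toZMod (p := p) : ℤ_[p] →* ZMod p) u) := by
  have hval : (x : ℚ_[p]).valuation = 1 := by
    rw [h, Padic.valuation_mul (NeZero.ne _) (by simp), Padic.valuation_p, PadicInt.valuation_coe,
      padicInt_valuation_unit, Nat.cast_zero, add_zero]
  have hpart : padicUnitPart x = u := by
    refine Units.ext (Subtype.ext ?_)
    rw [padicUnitPart_coe, hval, h, zpow_neg_one, mul_comm, inv_mul_cancel_left₀ (NeZero.ne _)]
  rw [padicResidueUnit, if_pos (hval ▸ odd_one), hpart]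

lemma residue_unit_primeUnit_mul {a : ℚˣ} {n : ℤ} (ha : (a : ℚ) = n) {u : (ZMod p)ˣ}
    (hu : (u : ZMod p) = n) : residue p (unit (primeUnit p * a)) = unit u := by
  have hn : IsUnit (n : ℤ_[p]) := by
    by_contra hn
    rw [PadicInt.not_isUnit_iff, PadicInt.norm_int_lt_one_iff_dvd,
      ← ZMod.intCast_zmod_eq_zero_iff_dvd, ← hu] at hn
    exact u.ne_zero hn
  have hx : ((Units.map (algebraMap ℚ ℚ_[p] : ℚ →* ℚ_[p]) (primeUnit p * a) : ℚ_[p]ˣ) : ℚ_[p]) =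
      p * (hn.unit : ℤ_[p]) := by
    simp [ha]
  rw [residue_unit, padicResidueUnit_of_eq_prime_mul hx]
  congr 1
  ext
  simp [hu]

lemma residue_unit_primeUnit_self : residue p (unit (primeUnit p)) = unit 1 := by
  rw [← mul_one (primeUnit p)]
  exact residue_unit_primeUnit_mul (n := 1) (by simp) (by simp)

lemma residue_unit_primeUnit_of_ne {q : ℕ} [Fact q.Prime] (h : q ≠ p) :
    residue q (unit (primeUnit p)) = 0 :=
  residue_unit_of_even q (padicValRat_primeUnit_of_ne h ▸ Even.zero)

end Residue

lemma unit_eq_or_eq_neg_of_rankParity_residue_eq {a b : ℚˣ}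
    (h : ∀ (q : ℕ) [Fact q.Prime],
      rankParity _ (residue q (unit a)) = rankParity _ (residue q (unit b))) :
    unit a = unit b ∨ unit a = -unit b := by
  have heven (q : ℕ) [Fact q.Prime] : Even (padicValRat q (a * b)) := by
    have hq := h q
    rw [rankParity_residue_unit, rankParity_residue_unit] at hq
    rw [padicValRat.mul a.ne_zero b.ne_zero, ← ZMod.intCast_eq_zero_iff_even, Int.cast_add, hq,
      CharTwo.add_self_eq_zero]
  rw [unit_eq_unit_iff, ← add_eq_zero_iff_eq_neg, unit_add_unit_eq_zero_iff]
  exact isSquare_or_isSquare_neg_of_forall_even_padicValRat (mul_ne_zero a.ne_zero b.ne_zero) heven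

section LowerBound

variable {p : ℕ} [Fact p.Prime]

lemma residue_unit_eq_of_rankParity_residue_eq (hneg : IsSquare (-1 : ZMod p)) {a b : ℚˣ}
    (h : ∀ (q : ℕ) [Fact q.Prime],
      rankParity _ (residue q (unit a)) = rankParity _ (residue q (unit b))) :
    residue p (unit a) = residue p (unit b) := by
  rcases unit_eq_or_eq_neg_of_rankParity_residue_eq h with hab | hab
  · rw [hab]
  · rw [hab, map_neg, neg_eq_self hneg]

lemma exists_mk_eq_sum_unit_of_rank_eq {n : ℕ} {B : SymForm ℚ} (h : B.rank = n) :
    ∃ a : Fin n → ℚˣ, mk B = ∑ i, unit (a i) :=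
  h ▸ mk_eq_sum_unit two_ne_zero B

lemma two_le_rank_of_residue_eq_unit (hneg : IsSquare (-1 : ZMod p)) {β : (ZMod p)ˣ}
    (hβ : ¬ IsSquare (β : ZMod p)) {B : SymForm ℚ} (hBp : residue p (mk B) = unit β)
    (hBq : ∀ (q : ℕ) [Fact q.Prime], q ≠ p → rankParity _ (residue q (mk B)) = 0) :
    2 ≤ B.rank := by
  by_contra! hlt
  obtain h0 | h1 : B.rank = 0 ∨ B.rank = 1 := by lia
  · obtain ⟨a, ha⟩ := exists_mk_eq_sum_unit_of_rank_eq h0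
    rw [ha, Fin.sum_univ_zero, map_zero] at hBp
    simpa using congrArg (rankParity _) hBp
  · obtain ⟨a, ha⟩ := exists_mk_eq_sum_unit_of_rank_eq h1
    rw [ha, Fin.sum_univ_one] at hBp hBq
    have heq : residue p (unit (a 0)) = residue p (unit (primeUnit p)) := by
      refine residue_unit_eq_of_rankParity_residue_eq hneg fun q _ => ?_
      rcases eq_or_ne q p with rfl | hqp
      · rw [hBp, residue_unit_primeUnit_self, rankParity_unit, rankParity_unit]
      · rw [hBq q hqp, residue_unit_primeUnit_of_ne hqp, map_zero]
    rw [hBp, residue_unit_primeUnit_self, unit_eq_unit_iff, Units.val_one, mul_one] at heq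
    exact hβ heq

lemma three_le_rank_of_residue_ne_zero (hneg : IsSquare (-1 : ZMod p)) {B : SymForm ℚ}
    (hBp : residue p (mk B) ≠ 0)
    (hB : ∀ (q : ℕ) [Fact q.Prime], rankParity _ (residue q (mk B)) = 0) : 3 ≤ B.rank := by
  by_contra! hlt
  refine hBp ?_
  obtain h0 | h1 | h2 : B.rank = 0 ∨ B.rank = 1 ∨ B.rank = 2 := by lia
  · obtain ⟨a, ha⟩ := exists_mk_eq_sum_unit_of_rank_eq h0
    rw [ha, Fin.sum_univ_zero, map_zero]
  · obtain ⟨a, ha⟩ := exists_mk_eq_sum_unit_of_rank_eq h1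
    rw [ha, Fin.sum_univ_one] at hB ⊢
    refine residue_unit_of_even p ?_
    rw [← ZMod.intCast_eq_zero_iff_even, ← rankParity_residue_unit, hB]
  · obtain ⟨a, ha⟩ := exists_mk_eq_sum_unit_of_rank_eq h2
    rw [ha, Fin.sum_univ_two] at hB ⊢
    have heq : residue p (unit (a 0)) = residue p (unit (a 1)) := by
      refine residue_unit_eq_of_rankParity_residue_eq hneg fun q _ => ?_
      rw [← CharTwo.add_eq_zero, ← map_add, ← map_add, hB q]
    rw [map_add, heq, add_eq_zero_iff_eq_neg, neg_eq_self hneg]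

end LowerBound

section UpperBound

variable {p : ℕ} [Fact p.Prime]

lemma exists_rank_two_and_residue_eq_unit (hp : p % 4 = 1) {β : (ZMod p)ˣ}
    (hβ : ¬ IsSquare (β : ZMod p)) :
    ∃ A : SymForm ℚ, A.rank = 2 ∧ residue p (mk A) = unit β ∧
      ∀ (q : ℕ) [Fact q.Prime], q ≠ p → residue q (mk A) = 0 := by
  obtain ⟨r, hr, hrβ, hsq⟩ := exists_prime_eq_and_isSquare_neg hp hβ
  have : Fact r.Prime := ⟨hr⟩
  have hpr : p ≠ r := by
    rintro rfl
    exact β.ne_zero (hrβ.symm.trans (ZMod.natCast_self _))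
  refine ⟨(SymForm.rankOne (primeUnit p * primeUnit r)).oplus (SymForm.rankOne (primeUnit r)),
    by rw [SymForm.rank_oplus, SymForm.rank_rankOne, SymForm.rank_rankOne], ?_, fun q _ hqp => ?_⟩
  all_goals rw [mk_oplus, map_add, mk_rankOne, mk_rankOne]
  · rw [residue_unit_primeUnit_mul (n := r) (by simp) (u := β) (by simp [hrβ]),
      residue_unit_primeUnit_of_ne hpr, add_zero]
  rcases eq_or_ne q r with rfl | hqr
  · have hp0 : (p : ZMod q) ≠ 0 := by
      rw [Ne, ZMod.natCast_eq_zero_iff, Nat.prime_dvd_prime_iff_eq Fact.out Fact.out]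
      exact hqp
    rw [mul_comm (primeUnit p),
      residue_unit_primeUnit_mul (n := p) (by simp) (u := Units.mk0 (p : ZMod q) hp0) (by simp),
      residue_unit_primeUnit_self, unit_add_unit_eq_zero_iff, Units.val_one, mul_one,
      Units.val_mk0]
    exact hsq
  · have heven : Even (padicValRat q ↑(primeUnit p * primeUnit r)) := by
      rw [Units.val_mul, padicValRat.mul (Units.ne_zero _) (Units.ne_zero _),
        padicValRat_primeUnit_of_ne hqp, padicValRat_primeUnit_of_ne hqr]
      exact Even.zero
    rw [residue_unit_of_even q heven, residue_unit_primeUnit_of_ne hqr, add_zero]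

lemma exists_rank_three_and_residue_eq_unit_one_add_unit (hp : p % 4 = 1) {β : (ZMod p)ˣ}
    (hβ : ¬ IsSquare (β : ZMod p)) :
    ∃ A : SymForm ℚ, A.rank = 3 ∧ residue p (mk A) = unit 1 + unit β ∧
      ∀ (q : ℕ) [Fact q.Prime], q ≠ p → residue q (mk A) = 0 := by
  obtain ⟨A, hA, hAp, hAq⟩ := exists_rank_two_and_residue_eq_unit hp hβ
  refine ⟨(SymForm.rankOne (primeUnit p)).oplus A,
    by rw [SymForm.rank_oplus, SymForm.rank_rankOne, hA], ?_, fun q _ hqp => ?_⟩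
  all_goals rw [mk_oplus, map_add, mk_rankOne]
  · rw [residue_unit_primeUnit_self, hAp]
  · rw [residue_unit_primeUnit_of_ne hqp, hAq q hqp, add_zero]

end UpperBound

section WittSpan

variable {p : ℕ} [Fact p.Prime] {w : WittGroup ℚ}

lemma boundary_eq_iff {v : WittGroup ℚ} :
    boundary v = boundary w ↔ ∀ (q : ℕ) [Fact q.Prime], residue q v = residue q w :=
  ⟨fun h q hq => congrFun h ⟨q, hq.out⟩, fun h => funext fun q => h q⟩

lemma wittSpan_eq_of_residue_eq_zero (hw : ∀ (q : ℕ) [Fact q.Prime], q ≠ p → residue q w = 0)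
    {n : ℕ} (hex : ∃ A : SymForm ℚ, A.rank = n ∧ residue p (mk A) = residue p w ∧
      ∀ (q : ℕ) [Fact q.Prime], q ≠ p → residue q (mk A) = 0)
    (hmin : ∀ B : SymForm ℚ, residue p (mk B) = residue p w →
      (∀ (q : ℕ) [Fact q.Prime], q ≠ p → residue q (mk B) = 0) → n ≤ B.rank) :
    w.wittSpan = n := by
  refine IsLeast.csInf_eq ⟨?_, ?_⟩
  · obtain ⟨A, hA, hAp, hAq⟩ := hex
    refine ⟨A, hA, boundary_eq_iff.mpr fun q _ => ?_⟩
    rcases eq_or_ne q p with rfl | hqp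
    · exact hAp
    · rw [hAq q hqp, hw q hqp]
  · rintro _ ⟨B, rfl, hB⟩
    rw [boundary_eq_iff] at hB
    exact hmin B (hB p) fun q _ hqp => (hB q).trans (hw q hqp)

end WittSpan

end WittGroup

open WittGroup in
theorem theorem1p5_general (W : WittGroup ℚ) (p : ℕ) [Fact p.Prime] (hp : p % 4 = 1)
    (β : (ZMod p)ˣ) (hβ : ¬ IsSquare (β : ZMod p))
    (hq : ∀ (q : ℕ) [Fact q.Prime], q ≠ p → residue q W = 0) :
    (residue p W = unit β → W.wittSpan = 2) ∧
    (residue p W = unit 1 + unit β → W.wittSpan = 3) := by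
  have hneg : IsSquare (-1 : ZMod p) := ZMod.exists_sq_eq_neg_one_iff.mpr (by lia)
  refine ⟨fun hW => ?_, fun hW => ?_⟩
  · refine wittSpan_eq_of_residue_eq_zero hq ?_ fun B hBp hBq => ?_
    · rw [hW]
      exact exists_rank_two_and_residue_eq_unit hp hβ
    · exact two_le_rank_of_residue_eq_unit hneg hβ (hBp.trans hW) fun q _ hqp => by
        rw [hBq q hqp, map_zero]
  · refine wittSpan_eq_of_residue_eq_zero hq ?_ fun B hBp hBq => ?_
    · rw [hW]
      exact exists_rank_three_and_residue_eq_unit_one_add_unit hp hβ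
    · rw [hW] at hBp
      refine three_le_rank_of_residue_ne_zero hneg (hBp ▸ unit_one_add_unit_ne_zero hneg hβ)
        fun q _ => ?_
      rcases eq_or_ne q p with rfl | hqp
      · rw [hBp, map_add, rankParity_unit, rankParity_unit, CharTwo.add_self_eq_zero]
      · rw [hBq q hqp, map_zero]

theorem theorem1p5 (K : Knot) (W : WittGroup ℚ) (hW : K.IsWittClass W)
    (p : ℕ) [Fact p.Prime] (hp : p % 4 = 1)
    (β : (ZMod p)ˣ) (hβ : ¬ IsSquare (β : ZMod p))
    (hq : ∀ (q : ℕ) [Fact q.Prime], q ≠ p → WittGroup.residue q W = 0) :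
    (WittGroup.residue p W = WittGroup.unit β → W.wittSpan = 2) ∧
    (WittGroup.residue p W = WittGroup.unit 1 + WittGroup.unit β → W.wittSpan = 3) :=
  theorem1p5_general W p hp β hβ hq
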